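/- Let $f$ be a non-constant entire function. A system of fundamental domains of $f$ is a family $\{\Omega_j\}_j$ of non-empty connected open subsets of $\mathbb{C}$ (the tiles) such that: the $\Omega_j$ are pairwise disjoint and their closures cover $\mathbb{C}$; $f$ is injective on each $\Omega_j$ and $f(\Omega_j)$ is dense in $\mathbb{C}$; every boundary point $p$ of $\Omega_j$ is accessible from $\Omega_j$ (there is a continuous path in $\Omega_j\cup\{p\}$ which ends at $p$ and lies in $\Omega_j$ before its end point); every point of $\mathbb{C}$ has a neighbourhood that meets only finitely many of the boundaries $\partial\Omega_j$; and $f(\Omega_i)=f(\Omega_j)$ for all $i,j$, so that every tile is mapped conformally onto every other tile by a map $\phi$ with $f\circ\phi=f$. Two tiles $\Omega,\Omega'$ are neighbouring if $\Omega\cap\Omega'=\emptyset$ and $\partial\Omega\cap\partial\Omega'\neq\emptyset$. The generations about a tile $\Omega$ are $G_0(\Omega)=\{\Omega\}$ and, for $n\ge 1$, $G_n(\Omega)$ = the set of all neighbours of members of $G_{n-1}(\Omega)$ that belong to none of $G_0(\Omega),\dots,G_{n-1}(\Omega)$; put $g(\Omega,n)=|G_n(\Omega)|$. For a connected open set $D\subseteq\mathbb{C}$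 let $\mathrm{Aut}_D(f)$ be the group, under composition, of all biholomorphic maps $\phi:D\to D$ with $f\circ\phi=f$ on $D$ (the automorphic functions of $f$ on $D$). **Theorem.** Let $f$ be a non-constant entire function which has a system of fundamental domains $\{\Omega_j\}_j$, and let $D\subseteq\mathbb{C}$ be any connected open set which contains all the tiles $\Omega_j$. (a) If for every $j$ the numbers $g(\Omega_j,n)$, $n\ge1$, are finite and $$\lim_{n\to\infty}\frac{g(\Omega_j,n)}{\sum_{m=1}^{n}g(\Omega_j,m)}=0$$ (the quotient being read as $0$ if its denominator is $0$), then the discrete group $\mathrm{Aut}_D(f)$ is amenable, that is, it carries a left-invariant finitely additive probability measure defined on all its subsets. (b) In particular, if for every $j$ there are a real polynomial $P_j$ and constants $0<c_j<C_j$ such that $g(\Omega_j,n)$ is finite and $c_jP_j(n)\le g(\Omega_j,n)\le C_jP_j(n)$ for all integers $n\ge1$, then $\mathrm{Aut}_D(f)$ is amenable. -/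

import Mathlib

open Filter Topology

/-- `p` is an accessible boundary point of `U`: it lies on the boundary of `U` and is the end point
of a path which, apart from that end point, runs inside `U`. -/
def IsAccessiblePoint (U : Set ℂ) (p : ℂ) : Prop :=
  p ∈ frontier U ∧
    ∃ γ : ℝ → ℂ, ContinuousOn γ (Set.Icc 0 1) ∧ (∀ t ∈ Set.Ico (0 : ℝ) 1, γ t ∈ U) ∧ γ 1 = p

/-- A system of fundamental domains of `f`: a tiling of the plane by domains, each of which is
mapped injectively by `f` onto a dense set (a leaf of the inverse function) and has only accessible
boundary points, such that the boundaries of the tiles do not accumulate in the finite plane, and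
such that any tile is mapped onto any other one by a branch of `f⁻¹ ∘ f`. Since `f` is injective on
the tiles, the last condition says that all the tiles have the same image under `f`. -/
structure IsFundamentalSystem (f : ℂ → ℂ) {ι : Type*} (Ω : ι → Set ℂ) : Prop where
  isOpen : ∀ i, IsOpen (Ω i)
  isConnected : ∀ i, IsConnected (Ω i)
  disjoint : ∀ i j, i ≠ j → Disjoint (Ω i) (Ω j)
  cover : ⋃ i, closure (Ω i) = Set.univ
  injOn : ∀ i, Set.InjOn f (Ω i)
  dense_image : ∀ i, Dense (f '' Ω i)
  accessible : ∀ i, ∀ p ∈ frontier (Ω i), IsAccessiblePoint (Ω i) p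
  locallyFinite : LocallyFinite fun i => frontier (Ω i)
  image_eq : ∀ i j, f '' Ω i = f '' Ω j

/-- Two tiles are neighbouring if they are disjoint and their boundaries meet. -/
def Neighbouring {ι : Type*} (Ω : ι → Set ℂ) (i j : ι) : Prop :=
  Disjoint (Ω i) (Ω j) ∧ (frontier (Ω i) ∩ frontier (Ω j)).Nonempty

/-- The `n`-th generation about the tile `Ω i₀`, as a set of indices. The `0`-th generation is the
tile itself; the `(n+1)`-st one consists of all the neighbours of members of the `n`-th one that
belong to no earlier generation. -/
def generation {ι : Type*} (Ω : ι → Set ℂ) (i₀ : ι) : ℕ → Set ι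
  | 0 => {i₀}
  | n + 1 =>
    {j | ∃ i ∈ generation Ω i₀ n, Neighbouring Ω i j} \ ⋃ m : Fin (n + 1), generation Ω i₀ m.1
  decreasing_by all_goals omega

/-- The counting function of the generations about the tile `Ω i₀` (meaningful when the generations
are finite). -/
noncomputable def genCount {ι : Type*} (Ω : ι → Set ℂ) (i₀ : ι) (n : ℕ) : ℕ :=
  (generation Ω i₀ n).ncard

/-- `φ : D → D` is holomorphic. -/
def IsHolomorphicSelfMap {D : Set ℂ} (φ : D → D) : Prop :=
  ∃ Φ : ℂ → ℂ, DifferentiableOn ℂ Φ D ∧ ∀ z : D, Φ z = φ z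

theorem IsHolomorphicSelfMap.comp {D : Set ℂ} {φ ψ : D → D} (hφ : IsHolomorphicSelfMap φ)
    (hψ : IsHolomorphicSelfMap ψ) : IsHolomorphicSelfMap (φ ∘ ψ) := by
  obtain ⟨Φ, hΦ, h1⟩ := hφ
  obtain ⟨Ψ, hΨ, h2⟩ := hψ
  refine ⟨Φ ∘ Ψ, hΦ.comp hΨ ?_, ?_⟩
  · intro z hz
    have := h2 ⟨z, hz⟩
    simp only at this
    rw [this]
    exact (ψ ⟨z, hz⟩).2
  · intro z
    simp [h1, h2]

/-- The group, under composition, of the automorphic functions of `f` on the domain `D`: the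
biholomorphic maps `φ : D → D` with `f (φ z) = f z`. -/
def automorphicGroup (f : ℂ → ℂ) (D : Set ℂ) : Subgroup (Equiv.Perm D) where
  carrier := {φ | IsHolomorphicSelfMap φ ∧ IsHolomorphicSelfMap φ.symm ∧
    ∀ z : D, f (φ z) = f z}
  one_mem' := ⟨⟨id, differentiableOn_id, fun _ => rfl⟩, ⟨id, differentiableOn_id, fun _ => rfl⟩,
    fun _ => rfl⟩
  mul_mem' := by
    rintro φ ψ ⟨h1, h2, h3⟩ ⟨k1, k2, k3⟩
    refine ⟨h1.comp k1, k2.comp h2, fun z => ?_⟩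
    rw [Equiv.Perm.mul_apply, h3, k3]
  inv_mem' := by
    rintro φ ⟨h1, h2, h3⟩
    refine ⟨h2, h1, fun z => ?_⟩
    have := h3 (φ⁻¹ z)
    rw [← this]
    simp

/-- Amenability of a (discrete) group: there is a left-invariant finitely additive probability
measure defined on all the subsets of the group. -/
def IsAmenableGroup (G : Type*) [Group G] : Prop :=
  ∃ μ : Set G → ℝ, (∀ A, 0 ≤ μ A) ∧ μ Set.univ = 1 ∧
    (∀ A B, Disjoint A B → μ (A ∪ B) = μ A + μ B) ∧
    ∀ (g : G) (A : Set G), μ ((fun x => g * x) '' A) = μ A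

/-! The tiles are the components of the preimage of their common image, so an automorphic function,
preserving `f`, permutes them (`exists_mapsTo_tile`). If two of them send a tile into the same tile,
they agree there by injectivity of `f`, hence on `D` by the identity theorem (`automorphic_ext`):
the action is free. Join tiles whose boundaries meet inside `D`, where the automorphic functions
live. The group acts on this graph, which is connected (`connected_tileGraph`) and whose balls lie
in unions of generations.

So an orbit bounds the growth of every finitely generated subgroup by the size of these unions,
which is subexponential under (a) and (b). Then some powers of a finite set are Følner sets, and an
ultralimit of densities is an invariant mean. -/

section Amenability

/-! ### Følner sets and subexponential growth -/

open scoped Pointwise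

/-- A group with Følner sets is amenable. -/
theorem isAmenableGroup_of_foelner {G : Type*} [Group G] [DecidableEq G]
    (h : ∀ (S : Finset G) (ε : ℝ), 0 < ε → ∃ F : Finset G, F.Nonempty ∧
      ∀ s ∈ S, (((F.image (s * ·)) \ F).card : ℝ) ≤ ε * F.card) :
    IsAmenableGroup G := by
  classical
  choose F hne hF using fun p : Finset G × ℕ => h p.1 (1 / ((p.2 : ℝ) + 1)) (by positivity)
  let U : Ultrafilter (Finset G × ℕ) := Ultrafilter.of atTop
  have hU : (U : Filter (Finset G × ℕ)) ≤ atTop := Ultrafilter.of_le _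
  have hpos : ∀ p, (0 : ℝ) < (F p).card := fun p => by exact_mod_cast (hne p).card_pos
  let m : Set G → Finset G × ℕ → ℝ := fun A p => (((F p).filter (· ∈ A)).card : ℝ) / (F p).card
  have hm0 : ∀ A p, 0 ≤ m A p := fun A p => by positivity
  have hm1 : ∀ A p, m A p ≤ 1 := fun A p => by
    refine div_le_one_of_le₀ ?_ (hpos p).le
    exact_mod_cast Finset.card_filter_le _ _
  have hlim : ∀ A, ∃ x : ℝ, Tendsto (m A) U (𝓝 x) := fun A => by
    obtain ⟨x, -, hx⟩ := (isCompact_Icc (a := (0 : ℝ)) (b := 1)).ultrafilter_le_nhds (U.map (m A))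
      (by
        rw [le_principal_iff]
        exact Filter.mem_map.2 (Filter.univ_mem' fun p => ⟨hm0 A p, hm1 A p⟩))
    exact ⟨x, hx⟩
  choose μ hμ using hlim
  -- One inequality suffices: applied to `g⁻¹` and the translate of `A`, it gives the other.
  have hle : ∀ (g : G) (A : Set G), μ ((fun x => g * x) '' A) ≤ μ A := by
    intro g A
    have hz : Tendsto (fun p : Finset G × ℕ => 1 / ((p.2 : ℝ) + 1)) U (𝓝 0) := by
      refine (tendsto_one_div_add_atTop_nhds_zero_nat.comp ?_).mono_left hU
      rw [← prod_atTop_atTop_eq]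
      exact tendsto_snd
    have hsum := (hμ A).add hz
    rw [add_zero] at hsum
    refine le_of_tendsto_of_tendsto (hμ _) hsum ?_
    have hev : ∀ᶠ p : Finset G × ℕ in U, ({g⁻¹}, 0) ≤ p := hU (eventually_ge_atTop _)
    filter_upwards [hev] with p hp
    have hg : g⁻¹ ∈ p.1 := hp.1 (Finset.mem_singleton_self _)
    have hb := hF p _ hg
    -- Translation by `g⁻¹` carries `F ∩ gA` into `A`; what leaves `F` lies in `g⁻¹F \ F`, which is
    -- small.
    have hcard : ((F p).filter (· ∈ (fun x => g * x) '' A)).card ≤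
        ((F p).filter (· ∈ A)).card + ((F p).image (g⁻¹ * ·) \ F p).card := by
      refine le_trans ?_ (Finset.card_union_le _ _)
      refine Finset.card_le_card_of_injOn (g⁻¹ * ·) ?_ (mul_right_injective _).injOn
      intro x hx
      simp only [Finset.coe_filter, Set.mem_ofPred_eq, Set.mem_image] at hx
      obtain ⟨hxF, a, ha, rfl⟩ := hx
      simp only [inv_mul_cancel_left, Finset.coe_union, Set.mem_union, Finset.mem_coe,
        Finset.mem_filter, Finset.mem_sdiff, Finset.mem_image]
      by_cases haF : a ∈ F p
      · exact Or.inl ⟨haF, ha⟩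
      · exact Or.inr ⟨⟨_, hxF, by simp⟩, haF⟩
    have hcard' : (((F p).filter (· ∈ (fun x => g * x) '' A)).card : ℝ) ≤
        ((F p).filter (· ∈ A)).card + ((F p).image (g⁻¹ * ·) \ F p).card := by
      exact_mod_cast hcard
    show _ / _ ≤ _ / _ + _
    rw [div_add' _ _ _ (hpos p).ne']
    gcongr
    linarith
  refine ⟨μ, fun A => ge_of_tendsto' (hμ A) (hm0 A), ?_, fun A B hAB => ?_, fun g A => ?_⟩
  · refine tendsto_nhds_unique (hμ _) ?_
    refine tendsto_const_nhds.congr fun p => ?_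
    simp [m, (hpos p).ne']
  · refine tendsto_nhds_unique (hμ _) (((hμ A).add (hμ B)).congr fun p => ?_)
    simp only [m]
    rw [← add_div]
    congr 1
    norm_cast
    rw [← Finset.card_union_of_disjoint]
    · congr 1
      ext x
      simp [and_or_left]
    · rw [Finset.disjoint_filter]
      exact fun x _ hA hB => Set.disjoint_left.1 hAB hA hB
  · refine le_antisymm (hle g A) ?_
    have := hle g⁻¹ ((fun x => g * x) '' A)
    rwa [Set.image_image, show (fun x => g⁻¹ * (g * x)) '' A = A by simp] at this

/-- `b` grows slower than every exponential sequence. -/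
def SubexponentialGrowth (b : ℕ → ℕ) : Prop :=
  ∀ r : ℝ, 1 < r → ∃ K : ℝ, ∀ n, (b n : ℝ) ≤ K * r ^ n

/-- A group is amenable if its finitely generated subgroups grow subexponentially. -/
theorem isAmenableGroup_of_subexponentialGrowth {G : Type*} [Group G] [DecidableEq G] {b : ℕ → ℕ}
    (hb : SubexponentialGrowth b)
    (h : ∀ T : Finset G, ∃ k : ℕ, ∀ n, (T ^ n).card ≤ b (k * n)) : IsAmenableGroup G := by
  refine isAmenableGroup_of_foelner fun S ε hε => ?_
  let T : Finset G := insert 1 S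
  obtain ⟨k, hk⟩ := h T
  -- The bound on `T ^ n` is at radius `k * n`, so `r ^ k` is what must stay below `1 + ε`.
  obtain ⟨r, hr1, hr⟩ : ∃ r : ℝ, 1 < r ∧ r ^ k < 1 + ε := by
    have hc : Tendsto (fun r : ℝ => r ^ k) (𝓝[>] 1) (𝓝 1) := by
      have : Continuous fun r : ℝ => r ^ k := by fun_prop
      simpa using (this.tendsto 1).mono_left nhdsWithin_le_nhds
    have h1 := hc.eventually_lt_const (show (1 : ℝ) < 1 + ε by linarith)
    obtain ⟨r, hr⟩ := (h1.and self_mem_nhdsWithin).exists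
    exact ⟨r, hr.2, hr.1⟩
  obtain ⟨K, hK⟩ := hb r hr1
  have h1T : (1 : G) ∈ T := Finset.mem_insert_self _ _
  have hex : ∃ n, ((T ^ (n + 1)).card : ℝ) ≤ (1 + ε) * (T ^ n).card := by
    by_contra! hcon
    have hlow : ∀ n, (1 + ε) ^ n ≤ ((T ^ n).card : ℝ) := by
      intro n
      induction n with
      | zero => simp
      | succ n ih =>
        rw [pow_succ']
        exact (mul_le_mul_of_nonneg_left ih (by linarith)).trans (hcon n).le
    have hrk : 0 < r ^ k := by positivity
    have hq : 1 < (1 + ε) / r ^ k := (one_lt_div hrk).2 hr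
    obtain ⟨n, hn⟩ := pow_unbounded_of_one_lt K hq
    rw [div_pow, lt_div_iff₀ (by positivity), ← pow_mul] at hn
    have h2 : ((T ^ n).card : ℝ) ≤ b (k * n) := by exact_mod_cast hk n
    linarith [hlow n, hK (k * n)]
  obtain ⟨n, hn⟩ := hex
  refine ⟨T ^ n, ⟨1, by simpa using Finset.pow_mem_pow h1T (n := n)⟩, fun s hs => ?_⟩
  have hsub : (T ^ n).image (s * ·) \ T ^ n ⊆ T ^ (n + 1) \ T ^ n := by
    refine Finset.sdiff_subset_sdiff (fun x hx => ?_) subset_rfl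
    obtain ⟨y, hy, rfl⟩ := Finset.mem_image.1 hx
    rw [pow_succ']
    exact Finset.mul_mem_mul (Finset.mem_insert_of_mem hs) hy
  have hmono : T ^ n ⊆ T ^ (n + 1) := Finset.pow_subset_pow_right h1T (Nat.le_succ n)
  have hc1 : ((((T ^ n).image (s * ·) \ T ^ n).card : ℕ) : ℝ) ≤ ((T ^ (n + 1) \ T ^ n).card : ℕ) := by
    exact_mod_cast Finset.card_le_card hsub
  have hc2 : (((T ^ (n + 1) \ T ^ n).card : ℕ) : ℝ) + (T ^ n).card = (T ^ (n + 1)).card := by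
    exact_mod_cast Finset.card_sdiff_add_card_eq_card hmono
  linarith

/-- A group acting on a connected graph whose balls about some vertex with trivial stabilizer grow
subexponentially is amenable. -/
theorem isAmenableGroup_of_graph {G V : Type*} [Group G] [MulAction G V] (Γ : SimpleGraph V)
    (hΓ : Γ.Connected) (hadj : ∀ (g : G) {v w : V}, Γ.Adj v w → Γ.Adj (g • v) (g • w)) (v₀ : V)
    (hfree : Function.Injective fun g : G => g • v₀) {B : ℕ → Set V} (hfin : ∀ n, (B n).Finite)
    (hB : ∀ v, ∀ n, Γ.dist v₀ v ≤ n → v ∈ B n)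
    (hgrowth : SubexponentialGrowth fun n => (B n).ncard) : IsAmenableGroup G := by
  classical
  refine isAmenableGroup_of_subexponentialGrowth hgrowth fun T => ?_
  have hdist : ∀ (g : G) (v w : V), Γ.dist (g • v) (g • w) ≤ Γ.dist v w := by
    intro g v w
    obtain ⟨p, hp⟩ := hΓ.exists_walk_length_eq_dist v w
    let φ : Γ →g Γ := ⟨fun v => g • v, fun h => hadj g h⟩
    rw [← hp, ← SimpleGraph.Walk.length_map φ p]
    exact SimpleGraph.dist_le _
  -- The largest displacement of `v₀` by an element of `T`; products of `n` elements move `v₀` at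
  -- most `k * n`.
  let k := T.sup fun g => Γ.dist v₀ (g • v₀)
  have hk : ∀ n, ∀ g ∈ T ^ n, Γ.dist v₀ (g • v₀) ≤ k * n := by
    intro n
    induction n with
    | zero => simp
    | succ n ih =>
      intro g hg
      rw [pow_succ, Finset.mem_mul] at hg
      obtain ⟨a, ha, c, hc, rfl⟩ := hg
      have h1 : Γ.dist v₀ ((a * c) • v₀) ≤ Γ.dist v₀ (a • v₀) + Γ.dist (a • v₀) ((a * c) • v₀) :=
        hΓ.dist_triangle
      have h2 : Γ.dist (a • v₀) ((a * c) • v₀) ≤ k := by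
        rw [mul_smul]
        exact (hdist _ _ _).trans (Finset.le_sup (f := fun g => Γ.dist v₀ (g • v₀)) hc)
      have := ih a ha
      rw [Nat.mul_succ]
      omega
  refine ⟨k, fun n => ?_⟩
  rw [← Set.ncard_coe_finset]
  exact Set.ncard_le_ncard_of_injOn (fun g => g • v₀) (fun g hg => hB _ _ (hk n g hg))
    hfree.injOn (hfin _)

/-! ### Growth of partial sums -/

/-- Eventually the last increment is at most the fraction `1 - 1 / r` of the new total, so each step
multiplies `b` by at most `r`. -/
theorem subexponentialGrowth_of_tendsto_div {g b : ℕ → ℕ}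
    (hb : ∀ n, (b n : ℝ) = 1 + ∑ m ∈ Finset.Icc 1 n, (g m : ℝ))
    (h : Tendsto (fun n : ℕ => (g n : ℝ) / ∑ m ∈ Finset.Icc 1 n, (g m : ℝ)) atTop (𝓝 0)) :
    SubexponentialGrowth b := by
  intro r hr
  have hstep : ∀ n, (b (n + 1) : ℝ) = b n + g (n + 1) := fun n => by
    rw [hb, hb, Finset.sum_Icc_succ_top (by omega)]
    ring
  have hmono : Monotone b := monotone_nat_of_le_succ fun n => by
    have := hstep n
    have : b (n + 1) = b n + g (n + 1) := by exact_mod_cast this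
    omega
  have hε : 0 < 1 - 1 / r := by
    have : 1 / r < 1 := (div_lt_one (by linarith)).2 hr
    linarith
  obtain ⟨N, hN⟩ := eventually_atTop.1 (h.eventually_le_const hε)
  have hg : ∀ n, N ≤ n → (b (n + 1) : ℝ) ≤ r * b n := by
    intro n hn
    have h1 := hN (n + 1) (by omega)
    have hs : (g (n + 1) : ℝ) ≤ ∑ m ∈ Finset.Icc 1 (n + 1), (g m : ℝ) :=
      Finset.single_le_sum (f := fun m => (g m : ℝ)) (fun _ _ => by positivity)
        (Finset.mem_Icc.2 ⟨by omega, le_rfl⟩)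
    have h2 : (g (n + 1) : ℝ) ≤ (1 - 1 / r) * b (n + 1) := by
      rw [hb]
      -- A zero denominator forces `g (n + 1) = 0`, so the default value of the quotient does no
      -- harm.
      rcases (show (0 : ℝ) ≤ ∑ m ∈ Finset.Icc 1 (n + 1), (g m : ℝ) by positivity).eq_or_lt with h0 | h0
      · rw [← h0] at hs ⊢
        linarith
      · rw [div_le_iff₀ h0] at h1
        linarith
    have h3 := hstep n
    have h4 : (1 / r) * b (n + 1) ≤ (b n : ℝ) := by linarith
    rw [one_div, inv_mul_le_iff₀ (by linarith)] at h4
    exact h4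
  refine ⟨b N, fun n => ?_⟩
  rcases le_total n N with hn | hn
  · have h1 : (b n : ℝ) ≤ b N := by exact_mod_cast hmono hn
    exact h1.trans (le_mul_of_one_le_right (by positivity) (one_le_pow₀ hr.le))
  · induction n, hn using Nat.le_induction with
    | base => exact le_mul_of_one_le_right (by positivity) (one_le_pow₀ hr.le)
    | succ n hn ih =>
      calc (b (n + 1) : ℝ) ≤ r * b n := hg n hn
        _ ≤ r * (b N * r ^ n) := by gcongr
        _ = b N * r ^ (n + 1) := by ring

theorem Polynomial.exists_eval_natCast_le_mul_pow (P : Polynomial ℝ) {r : ℝ} (hr : 1 < r) :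
    ∃ K : ℝ, 0 ≤ K ∧ ∀ n : ℕ, P.eval (n : ℝ) ≤ K * r ^ n := by
  induction P using Polynomial.induction_on' with
  | add p q hp hq =>
    obtain ⟨K, hK0, hK⟩ := hp
    obtain ⟨L, hL0, hL⟩ := hq
    refine ⟨K + L, by positivity, fun n => ?_⟩
    rw [Polynomial.eval_add, add_mul]
    exact add_le_add (hK n) (hL n)
  | monomial k a =>
    obtain ⟨M, hM⟩ := (tendsto_pow_const_div_const_pow_of_one_lt k hr).bddAbove_range
    have hM' : ∀ n : ℕ, (n : ℝ) ^ k ≤ M * r ^ n := fun n => by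
      rw [← div_le_iff₀ (by positivity)]
      exact hM ⟨n, rfl⟩
    have hM0 : 0 ≤ M := le_trans (by positivity) (hM ⟨1, rfl⟩)
    refine ⟨|a| * M, by positivity, fun n => ?_⟩
    rw [Polynomial.eval_monomial, mul_assoc]
    exact (mul_le_mul_of_nonneg_right (le_abs_self a) (by positivity)).trans
      (mul_le_mul_of_nonneg_left (hM' n) (abs_nonneg a))

theorem subexponentialGrowth_of_le_polynomial {g b : ℕ → ℕ}
    (hb : ∀ n, (b n : ℝ) = 1 + ∑ m ∈ Finset.Icc 1 n, (g m : ℝ)) (P : Polynomial ℝ)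
    (h : ∀ n : ℕ, 1 ≤ n → (g n : ℝ) ≤ P.eval (n : ℝ)) : SubexponentialGrowth b := by
  intro r hr
  obtain ⟨K, hK0, hK⟩ := P.exists_eval_natCast_le_mul_pow hr
  have hr1 : 0 < r - 1 := by linarith
  have hL : K * r ≤ (1 + K * r / (r - 1)) * (r - 1) := by
    rw [add_mul, div_mul_cancel₀ _ hr1.ne']
    linarith
  -- With this constant `L`, `L * (r - 1)` absorbs the increment `K * r`; the summand 1 covers `b 0
  -- = 1`.
  refine ⟨1 + K * r / (r - 1), fun n => ?_⟩
  induction n with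
  | zero =>
    rw [hb]
    have : 0 ≤ K * r / (r - 1) := by positivity
    simpa using this
  | succ n ih =>
    have hstep : (b (n + 1) : ℝ) = b n + g (n + 1) := by
      rw [hb, hb, Finset.sum_Icc_succ_top (by omega)]
      ring
    have h1 := (h (n + 1) (by omega)).trans (hK (n + 1))
    have h2 := mul_le_mul_of_nonneg_right hL (show 0 ≤ r ^ n by positivity)
    rw [hstep]
    calc (b n : ℝ) + g (n + 1) ≤ (1 + K * r / (r - 1)) * r ^ n + K * r ^ (n + 1) := add_le_add ih h1
      _ ≤ (1 + K * r / (r - 1)) * r ^ (n + 1) := by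
        rw [pow_succ]
        linarith

end Amenability

/-! ### Topology of the tiling -/

section Tiles

variable {ι : Type*} {Ω : ι → Set ℂ} {f : ℂ → ℂ} {D : Set ℂ}

namespace IsFundamentalSystem

theorem disjoint_closure (hΩ : IsFundamentalSystem f Ω) {i j : ι} (hij : i ≠ j) :
    Disjoint (Ω i) (closure (Ω j)) :=
  (hΩ.disjoint i j hij).closure_right (hΩ.isOpen i)

theorem eq_of_mem (hΩ : IsFundamentalSystem f Ω) {i j : ι} {z : ℂ} (hi : z ∈ Ω i) (hj : z ∈ Ω j) :
    i = j := by
  by_contra hij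
  exact Set.disjoint_left.1 (hΩ.disjoint i j hij) hi hj

theorem mem_frontier_of_mem_closure (hΩ : IsFundamentalSystem f Ω) {i j : ι} (hij : i ≠ j) {z : ℂ}
    (hi : z ∈ closure (Ω i)) (hj : z ∈ closure (Ω j)) : z ∈ frontier (Ω i) := by
  rw [(hΩ.isOpen i).frontier_eq]
  exact ⟨hi, fun h => Set.disjoint_left.1 (hΩ.disjoint_closure hij) h hj⟩

/-- No boundary point of a tile takes a value that is taken in the tile. -/
theorem mem_of_mem_closure (hΩ : IsFundamentalSystem f Ω) (hf : Continuous f)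
    (hopen : IsOpenMap f) {j : ι} {z : ℂ} (hz : z ∈ closure (Ω j)) (hfz : f z ∈ f '' Ω j) :
    z ∈ Ω j := by
  obtain ⟨q, hq, hqz⟩ := hfz
  by_contra hzj
  have hne : z ≠ q := fun h => hzj (h ▸ hq)
  obtain ⟨U, V, hU, hV, hzU, hqV, hUV⟩ := t2_separation hne
  -- Near `z` every value of `f` is also taken in `V ∩ Ω j`, so a point of `Ω j` near `z`
  -- contradicts injectivity.
  have hW : IsOpen (f ⁻¹' (f '' (V ∩ Ω j)) ∩ U) :=
    ((hopen _ (hV.inter (hΩ.isOpen j))).preimage hf).inter hU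
  obtain ⟨w, ⟨⟨v, ⟨hvV, hvj⟩, hvw⟩, hwU⟩, hwj⟩ :=
    mem_closure_iff.1 hz _ hW ⟨⟨q, ⟨hqV, hq⟩, hqz⟩, hzU⟩
  have : v = w := hΩ.injOn j hvj hwj hvw
  exact Set.disjoint_left.1 hUV hwU (this ▸ hvV)

/-- The tiles fill the preimage of their common image. -/
theorem exists_mem_of_map_mem (hΩ : IsFundamentalSystem f Ω) (hf : Continuous f)
    (hopen : IsOpenMap f) {i : ι} {z : ℂ} (hz : f z ∈ f '' Ω i) : ∃ j, z ∈ Ω j := by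
  obtain ⟨j, hj⟩ := Set.mem_iUnion.1 (hΩ.cover ▸ Set.mem_univ z : z ∈ ⋃ i, closure (Ω i))
  exact ⟨j, hΩ.mem_of_mem_closure hf hopen hj (hΩ.image_eq i j ▸ hz)⟩

/-- A ball meeting few boundaries either lies in one tile, and misses all other closures, or, being
connected, meets the boundary of every tile whose closure it meets. -/
theorem locallyFinite_closure (hΩ : IsFundamentalSystem f Ω) :
    LocallyFinite fun i => closure (Ω i) := by
  intro z
  obtain ⟨N, hN, hfin⟩ := hΩ.locallyFinite z
  obtain ⟨ε, hε, hball⟩ := Metric.mem_nhds_iff.1 hN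
  refine ⟨Metric.ball z ε, Metric.ball_mem_nhds z hε, ?_⟩
  by_cases hsub : ∃ i, Metric.ball z ε ⊆ Ω i
  · obtain ⟨i, hi⟩ := hsub
    refine (Set.finite_singleton i).subset fun j hj => ?_
    obtain ⟨w, hwj, hw⟩ := hj
    by_contra hij
    exact Set.disjoint_left.1 (hΩ.disjoint_closure (Ne.symm hij)) (hi hw) hwj
  · refine hfin.subset fun j hj => ?_
    obtain ⟨w, hwj, hw⟩ := hj
    obtain ⟨u, hu, huj⟩ := mem_closure_iff.1 hwj _ Metric.isOpen_ball hw
    by_contra hdis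
    refine hsub ⟨j, ?_⟩
    refine (convex_ball z ε).isPreconnected.subset_of_closure_inter_subset (hΩ.isOpen j)
      ⟨u, hu, huj⟩ fun v hv => ?_
    by_contra hvj
    refine hdis ⟨v, ?_, hball hv.2⟩
    exact ⟨hv.1, (hΩ.isOpen j).interior_eq.symm ▸ hvj⟩

end IsFundamentalSystem

/-! ### The graph of tiles and the generations -/

/-- The graph of the tiles, with an edge between two tiles if their boundaries meet inside `D`. -/
def tileGraph (Ω : ι → Set ℂ) (D : Set ℂ) : SimpleGraph ι where
  Adj i j := i ≠ j ∧ (frontier (Ω i) ∩ frontier (Ω j) ∩ D).Nonempty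
  symm := ⟨fun i j h => ⟨h.1.symm, by rw [Set.inter_comm (frontier (Ω j))]; exact h.2⟩⟩
  loopless := ⟨fun _ h => h.1 rfl⟩

/-- Otherwise the closures of the tiles in a component, and those of the others, form two closed
sets covering `D`. As `D` is connected they meet in `D`, which yields an edge between them. -/
theorem IsFundamentalSystem.connected_tileGraph (hΩ : IsFundamentalSystem f Ω)
    (hDc : IsConnected D) (hD : ∀ i, Ω i ⊆ D) : (tileGraph Ω D).Connected := by
  have hne : Nonempty ι := by
    obtain ⟨i, -⟩ := Set.mem_iUnion.1 (hΩ.cover ▸ Set.mem_univ 0 : (0 : ℂ) ∈ ⋃ i, closure (Ω i))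
    exact ⟨i⟩
  rw [SimpleGraph.connected_iff]
  refine ⟨fun i j => ?_, hne⟩
  by_contra hij
  let C : Set ι := {k | (tileGraph Ω D).Reachable i k}
  have hclosed : ∀ S : Set ι, IsClosed (⋃ k : S, closure (Ω k)) := fun S =>
    (hΩ.locallyFinite_closure.comp_injective Subtype.val_injective).isClosed_iUnion
      fun _ => isClosed_closure
  have hmeet : ∀ S : Set ι, ∀ k ∈ S, (D ∩ ⋃ k : S, closure (Ω k)).Nonempty := by
    intro S k hk
    obtain ⟨z, hz⟩ := (hΩ.isConnected k).nonempty
    exact ⟨z, hD k hz, Set.mem_iUnion.2 ⟨⟨k, hk⟩, subset_closure hz⟩⟩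
  obtain ⟨z, hzD, hz1, hz2⟩ := isPreconnected_closed_iff.1 hDc.isPreconnected _ _
    (hclosed C) (hclosed Cᶜ)
    (fun z _ => by
      obtain ⟨k, hk⟩ := Set.mem_iUnion.1 (hΩ.cover ▸ Set.mem_univ z : z ∈ ⋃ i, closure (Ω i))
      by_cases hkC : k ∈ C
      · exact Or.inl (Set.mem_iUnion.2 ⟨⟨k, hkC⟩, hk⟩)
      · exact Or.inr (Set.mem_iUnion.2 ⟨⟨k, hkC⟩, hk⟩))
    (hmeet C i (SimpleGraph.Reachable.refl i)) (hmeet Cᶜ j hij)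
  obtain ⟨⟨k, hk⟩, hzk⟩ := Set.mem_iUnion.1 hz1
  obtain ⟨⟨l, hl⟩, hzl⟩ := Set.mem_iUnion.1 hz2
  have hkl : k ≠ l := fun h => hl (h ▸ hk)
  have hadj : (tileGraph Ω D).Adj k l :=
    ⟨hkl, z, ⟨hΩ.mem_frontier_of_mem_closure hkl hzk hzl,
      hΩ.mem_frontier_of_mem_closure hkl.symm hzl hzk⟩, hzD⟩
  exact hl (SimpleGraph.Reachable.trans hk hadj.reachable)

/-- The tiles of the first `n` generations about a tile. -/
def generationBall (Ω : ι → Set ℂ) (i₀ : ι) (n : ℕ) : Set ι :=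
  ⋃ m ∈ Finset.range (n + 1), generation Ω i₀ m

theorem mem_generationBall {i₀ i : ι} {n : ℕ} :
    i ∈ generationBall Ω i₀ n ↔ ∃ m ≤ n, i ∈ generation Ω i₀ m := by
  simp [generationBall]

theorem generation_zero (i₀ : ι) : generation Ω i₀ 0 = {i₀} := by
  rw [generation]

theorem mem_generation_succ {i₀ j : ι} {n : ℕ} : j ∈ generation Ω i₀ (n + 1) ↔
    (∃ i ∈ generation Ω i₀ n, Neighbouring Ω i j) ∧ j ∉ generationBall Ω i₀ n := by
  rw [generation, mem_generationBall]
  simp only [Set.mem_sdiff, Set.mem_ofPred_eq, Set.mem_iUnion, Fin.exists_iff, Nat.lt_succ_iff,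
    exists_prop]

theorem generationBall_succ (i₀ : ι) (n : ℕ) :
    generationBall Ω i₀ (n + 1) = generationBall Ω i₀ n ∪ generation Ω i₀ (n + 1) := by
  rw [generationBall, Finset.range_add_one, Finset.set_biUnion_insert, Set.union_comm]
  rfl

theorem finite_generationBall {i₀ : ι} (h : ∀ n, 1 ≤ n → (generation Ω i₀ n).Finite) (n : ℕ) :
    (generationBall Ω i₀ n).Finite := by
  refine Set.Finite.biUnion (Finset.finite_toSet _) fun m _ => ?_
  rcases Nat.eq_zero_or_pos m with rfl | hm
  · rw [generation_zero]
    exact Set.finite_singleton _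
  · exact h m hm

theorem ncard_generationBall {i₀ : ι} (h : ∀ n, 1 ≤ n → (generation Ω i₀ n).Finite) (n : ℕ) :
    ((generationBall Ω i₀ n).ncard : ℝ) = 1 + ∑ m ∈ Finset.Icc 1 n, (genCount Ω i₀ m : ℝ) := by
  induction n with
  | zero => simp [generationBall, generation_zero]
  | succ n ih =>
    rw [generationBall_succ, Set.ncard_union_eq _ (finite_generationBall h n) (h _ (by omega)),
      Finset.sum_Icc_succ_top (by omega), Nat.cast_add, ih, add_assoc]
    · rfl
    · exact Set.disjoint_right.2 fun j hj => (mem_generation_succ.1 hj).2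

/-- Edges join neighbouring tiles, but neighbours may touch only outside `D`; so graph balls lie in
generation balls, perhaps properly. The walk ends at the centre, which induction on its first step
keeps fixed. -/
theorem IsFundamentalSystem.mem_generationBall_of_walk (hΩ : IsFundamentalSystem f Ω) {i j : ι}
    (p : (tileGraph Ω D).Walk j i) : j ∈ generationBall Ω i p.length := by
  induction p with
  | nil => exact mem_generationBall.2 ⟨0, le_rfl, by rw [generation_zero]; rfl⟩
  | @cons u v w huv p ih =>
    obtain ⟨m, hm, hv⟩ := mem_generationBall.1 ih
    have hvu : Neighbouring Ω v u := by
      obtain ⟨hne, z, ⟨hzu, hzv⟩, -⟩ := huv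
      exact ⟨hΩ.disjoint v u hne.symm, z, hzv, hzu⟩
    rw [SimpleGraph.Walk.length_cons]
    by_cases hu : u ∈ generationBall Ω w m
    · obtain ⟨l, hl, hul⟩ := mem_generationBall.1 hu
      exact mem_generationBall.2 ⟨l, by omega, hul⟩
    · exact mem_generationBall.2 ⟨m + 1, by omega, mem_generation_succ.2 ⟨⟨v, hv, hvu⟩, hu⟩⟩

theorem IsFundamentalSystem.mem_generationBall_of_dist_le (hΩ : IsFundamentalSystem f Ω)
    (hconn : (tileGraph Ω D).Connected) {i j : ι} {n : ℕ} (h : (tileGraph Ω D).dist i j ≤ n) :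
    j ∈ generationBall Ω i n := by
  obtain ⟨p, hp⟩ := hconn.exists_walk_length_eq_dist j i
  rw [SimpleGraph.dist_comm] at hp
  obtain ⟨m, hm, hj⟩ := mem_generationBall.1 (hΩ.mem_generationBall_of_walk p)
  exact mem_generationBall.2 ⟨m, by omega, hj⟩

/-! ### The action of the automorphic functions on the tiles -/

theorem IsHolomorphicSelfMap.continuous {φ : D → D} (hφ : IsHolomorphicSelfMap φ) :
    Continuous φ := by
  obtain ⟨Φ, hΦ, h⟩ := hφ
  refine continuous_induced_rng.2 ?_
  refine (continuousOn_iff_continuous_domRestrict.1 hΦ.continuousOn).congr h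

/-- An automorphic function maps every tile into a tile. -/
theorem IsFundamentalSystem.exists_mapsTo_tile (hΩ : IsFundamentalSystem f Ω) (hf : Continuous f)
    (hopen : IsOpenMap f) (hD : ∀ i, Ω i ⊆ D) (φ : automorphicGroup f D) (i : ι) :
    ∃ j, ∀ z : D, (z : ℂ) ∈ Ω i → (φ.1 z : ℂ) ∈ Ω j := by
  have hmem : ∀ z : D, (z : ℂ) ∈ Ω i → ∃ j, (φ.1 z : ℂ) ∈ Ω j := fun z hz =>
    hΩ.exists_mem_of_map_mem hf hopen (i := i) (by rw [φ.2.2.2 z]; exact ⟨z, hz, rfl⟩)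
  let g : Ω i → ℂ := fun z => φ.1 ⟨z, hD i z.2⟩
  have hg : Continuous g := continuous_subtype_val.comp
    (φ.2.1.continuous.comp (continuous_subtype_val.subtype_mk _))
  have hpre : IsPreconnected (Set.range g) := by
    have := Subtype.preconnectedSpace (hΩ.isConnected i).isPreconnected
    exact isPreconnected_range hg
  obtain ⟨z₀, hz₀⟩ := (hΩ.isConnected i).nonempty
  obtain ⟨j, hj⟩ := hmem ⟨z₀, hD i hz₀⟩ hz₀
  refine ⟨j, fun z hz => ?_⟩
  -- The image of the tile is connected and covered by disjoint open tiles, so it stays in one.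
  refine hpre.subset_left_of_subset_union (u := Ω j) (hΩ.isOpen j)
    (isOpen_iUnion fun k : {k // k ≠ j} => hΩ.isOpen k)
    (Set.disjoint_iUnion_right.2 fun k => hΩ.disjoint _ _ k.2.symm) ?_ ⟨g ⟨z₀, hz₀⟩, Set.mem_range_self _, hj⟩
    (Set.mem_range_self (f := g) ⟨z, hz⟩)
  rintro _ ⟨w, rfl⟩
  obtain ⟨k, hk⟩ := hmem ⟨w, hD i w.2⟩ w.2
  by_cases hkj : k = j
  · exact Or.inl (hkj ▸ hk)
  · exact Or.inr (Set.mem_iUnion.2 ⟨⟨k, hkj⟩, hk⟩)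

/-- Automorphic functions that map some tile into a common tile are equal. -/
theorem IsFundamentalSystem.automorphic_ext (hΩ : IsFundamentalSystem f Ω) (hDo : IsOpen D)
    (hDc : IsConnected D) (hD : ∀ i, Ω i ⊆ D) {φ ψ : automorphicGroup f D} {i j : ι}
    (hφ : ∀ z : D, (z : ℂ) ∈ Ω i → (φ.1 z : ℂ) ∈ Ω j)
    (hψ : ∀ z : D, (z : ℂ) ∈ Ω i → (ψ.1 z : ℂ) ∈ Ω j) : φ = ψ := by
  obtain ⟨Φ, hΦ, h1⟩ := φ.2.1
  obtain ⟨Ψ, hΨ, h2⟩ := ψ.2.1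
  obtain ⟨z₀, hz₀⟩ := (hΩ.isConnected i).nonempty
  have heq : Φ =ᶠ[𝓝 z₀] Ψ := by
    filter_upwards [(hΩ.isOpen i).mem_nhds hz₀] with z hz
    have hz' : z ∈ D := hD i hz
    have e1 := h1 ⟨z, hz'⟩
    have e2 := h2 ⟨z, hz'⟩
    simp only at e1 e2
    rw [e1, e2]
    exact hΩ.injOn j (hφ _ hz) (hψ _ hz) ((φ.2.2.2 _).trans (ψ.2.2.2 _).symm)
  have hD' := (hΦ.analyticOnNhd hDo).eqOn_of_preconnected_of_eventuallyEq
    (hΨ.analyticOnNhd hDo) hDc.isPreconnected (hD i hz₀) heq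
  refine Subtype.ext (Equiv.ext fun z => Subtype.ext ?_)
  rw [← h1 z, ← h2 z]
  exact hD' z.2

/-- The action of the automorphic functions on the tiles. -/
@[reducible]
noncomputable def IsFundamentalSystem.tileAction (hΩ : IsFundamentalSystem f Ω)
    (hf : Continuous f) (hopen : IsOpenMap f) (hD : ∀ i, Ω i ⊆ D) :
    MulAction (automorphicGroup f D) ι where
  smul φ i := (hΩ.exists_mapsTo_tile hf hopen hD φ i).choose
  one_smul i := by
    obtain ⟨z, hz⟩ := (hΩ.isConnected i).nonempty
    exact hΩ.eq_of_mem
      ((hΩ.exists_mapsTo_tile hf hopen hD 1 i).choose_spec ⟨z, hD i hz⟩ hz) hz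
  mul_smul φ ψ i := by
    obtain ⟨z, hz⟩ := (hΩ.isConnected i).nonempty
    exact hΩ.eq_of_mem
      ((hΩ.exists_mapsTo_tile hf hopen hD (φ * ψ) i).choose_spec ⟨z, hD i hz⟩ hz)
      ((hΩ.exists_mapsTo_tile hf hopen hD φ _).choose_spec _
        ((hΩ.exists_mapsTo_tile hf hopen hD ψ i).choose_spec ⟨z, hD i hz⟩ hz))

theorem IsFundamentalSystem.isAmenableGroup_automorphicGroup (hΩ : IsFundamentalSystem f Ω)
    (hf : Continuous f) (hopen : IsOpenMap f) (hDo : IsOpen D) (hDc : IsConnected D)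
    (hD : ∀ i, Ω i ⊆ D) (i₀ : ι) (hfin : ∀ n, 1 ≤ n → (generation Ω i₀ n).Finite)
    (hgrowth : SubexponentialGrowth fun n => (generationBall Ω i₀ n).ncard) :
    IsAmenableGroup (automorphicGroup f D) := by
  let act := hΩ.tileAction hf hopen hD
  have hmem : ∀ (φ : automorphicGroup f D) (i : ι) (z : D), (z : ℂ) ∈ Ω i →
      (φ.1 z : ℂ) ∈ Ω (φ • i) := fun φ i =>
    (hΩ.exists_mapsTo_tile hf hopen hD φ i).choose_spec
  have hfr : ∀ (φ : automorphicGroup f D) (i : ι) (z : D), (z : ℂ) ∈ frontier (Ω i) →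
      (φ.1 z : ℂ) ∈ frontier (Ω (φ • i)) := by
    intro φ i z hz
    rw [(hΩ.isOpen _).frontier_eq] at hz ⊢
    refine ⟨?_, fun h => hz.2 ?_⟩
    · have hcont : Continuous fun w : D => (φ.1 w : ℂ) :=
        continuous_subtype_val.comp φ.2.1.continuous
      have hcl : z ∈ closure ((↑) ⁻¹' Ω i : Set D) := by
        refine mem_closure_iff.2 fun U hU hzU => ?_
        obtain ⟨V, hV, rfl⟩ := isOpen_induced_iff.1 hU
        obtain ⟨w, hwV, hwi⟩ := mem_closure_iff.1 hz.1 V hV hzU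
        exact ⟨⟨w, hD i hwi⟩, hwV, hwi⟩
      exact map_mem_closure (f := fun w : D => (φ.1 w : ℂ)) hcont hcl (hmem φ i)
    -- If the image were interior to a tile, `φ⁻¹` would carry it back inside `Ω i`.
    · have := hmem φ⁻¹ _ _ h
      rw [inv_smul_smul] at this
      simpa using this
  have hconn := hΩ.connected_tileGraph hDc hD
  refine isAmenableGroup_of_graph (tileGraph Ω D) hconn ?_ i₀ ?_ (finite_generationBall hfin)
    (fun j n h => hΩ.mem_generationBall_of_dist_le hconn h) hgrowth
  · rintro φ i j ⟨hne, z, ⟨hzi, hzj⟩, hzD⟩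
    exact ⟨fun h => hne (MulAction.injective φ h), φ.1 ⟨z, hzD⟩,
      ⟨hfr φ i ⟨z, hzD⟩ hzi, hfr φ j ⟨z, hzD⟩ hzj⟩, (φ.1 ⟨z, hzD⟩).2⟩
  · intro φ ψ h
    refine hΩ.automorphic_ext hDo hDc hD (hmem φ i₀) ?_
    rw [show φ • i₀ = ψ • i₀ from h]
    exact hmem ψ i₀

end Tiles

theorem theorem28 (f : ℂ → ℂ) (hf : Differentiable ℂ f) (hnc : ¬ ∃ c : ℂ, ∀ z, f z = c)
    {ι : Type*} (Ω : ι → Set ℂ) (hΩ : IsFundamentalSystem f Ω)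
    (D : Set ℂ) (hDo : IsOpen D) (hDc : IsConnected D) (hD : ∀ i, Ω i ⊆ D) :
    ((∀ i, (∀ n : ℕ, 1 ≤ n → (generation Ω i n).Finite) ∧
        Tendsto (fun n : ℕ => (genCount Ω i n : ℝ) / ∑ m ∈ Finset.Icc 1 n, (genCount Ω i m : ℝ))
          atTop (𝓝 0)) →
      IsAmenableGroup (automorphicGroup f D)) ∧
    ((∀ i, ∃ (P : Polynomial ℝ) (c C : ℝ), 0 < c ∧ c < C ∧ ∀ n : ℕ, 1 ≤ n →
        (generation Ω i n).Finite ∧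
        c * P.eval (n : ℝ) ≤ (genCount Ω i n : ℝ) ∧ (genCount Ω i n : ℝ) ≤ C * P.eval (n : ℝ)) →
      IsAmenableGroup (automorphicGroup f D)) := by
  have hopen : IsOpenMap f :=
    (AnalyticOnNhd.is_constant_or_isOpenMap
      (hf.differentiableOn.analyticOnNhd isOpen_univ)).resolve_left hnc
  obtain ⟨i₀⟩ := (hΩ.connected_tileGraph hDc hD).nonempty
  constructor
  · intro h
    obtain ⟨hfin, hlim⟩ := h i₀
    exact hΩ.isAmenableGroup_automorphicGroup hf.continuous hopen hDo hDc hD i₀ hfin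
      (subexponentialGrowth_of_tendsto_div (ncard_generationBall hfin) hlim)
  · intro h
    obtain ⟨P, c, C, -, -, h⟩ := h i₀
    have hfin := fun n hn => (h n hn).1
    refine hΩ.isAmenableGroup_automorphicGroup hf.continuous hopen hDo hDc hD i₀ hfin
      (subexponentialGrowth_of_le_polynomial (ncard_generationBall hfin) (Polynomial.C C * P) ?_)
    intro n hn
    rw [Polynomial.eval_mul, Polynomial.eval_C]
    exact (h n hn).2.2
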